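/- Let $p$ be a prime, $k\ge 1$, $m=p^k$, $r\in\mathbb N$, and let $T=T_{f[-r,r]}$ be the one-dimensional linear cellular automaton on $X=\mathbb Z_m^{\mathbb Z}$ with local rule $$f(x_{-r},\dots,x_r)=\sum_{i=-r}^{r}a_ix_i \pmod{p^k},\qquad (Tx)_n=f(x_{n-r},\dots,x_{n+r}).$$ Assume that $f$ is permutative on both sides: $f$ is permutative in some variable $x_i$ with $i<0$ and in some variable $x_j$ with $j>0$ (permutative in $x_i$ means that, for every choice of the other variables, $x_i\mapsto f(x_{-r},\dots,x_r)$ is a permutation of $\mathbb Z_m$). This holds in particular if $r\ge 1$ and $f$ is permutative in its extreme variables $x_{-r}$ and $x_r$. Put $$P=\{0\}\cup\{j\in\{-r,\dots,r\}:\gcd(a_j,p)=1\},\quad L=\min P,\quad R=\max P,\quad \theta_L=\operatorname{arccot}(-L),\quad \theta_R=\operatorname{arccot}(-R),$$ where $\operatorname{arccot}$ takes values in $(0,\pi)$. Let $\sigma$ be the shift, $(\sigma x)_i=x_{i+1}$, let $\Phi^{(n,t)}=\sigma^nT^t$ for $n\in\mathbb Z$, $t\in\mathbb Z_{\ge 0}$,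 and let $d(x,y)=\sum_{i\in\mathbb Z}|x_i-y_i|\,m^{-|i|}$ with residues represented by $0,\dots,m-1$. For $w\in\mathbb N$, $\tau>0$ and $\theta\in[0,\pi]$ let $$W(w,\tau,\theta)=\{(x+y\cos\theta,\;y\sin\theta): -w<x<w,\ 0<y\le \tau\}.$$ A set $M\subset X$ is $(\varepsilon,W)$-separated if for all distinct $x,\bar x\in M$ there is $(n,t)\in W\cap(\mathbb Z\times\mathbb Z_{\ge0})$ with $d(\Phi^{(n,t)}x,\Phi^{(n,t)}\bar x)\ge\varepsilon$; let $N(\varepsilon,W)$ be the largest cardinality of such a set. The topological directional entropy of $\Phi$ in the direction $(\cos\theta,\sin\theta)$ is $$h_\theta(\Phi)=\lim_{\varepsilon\to0^+}\ \limsup_{w\to\infty}\ \limsup_{\tau\to\infty}\ \frac1\tau\log N(\varepsilon,W(w,\tau,\theta)).$$ Then for every $\theta\in[0,\pi]$ this limit exists, and $$h_\theta(\Phi)=\begin{cases}k\,|\cos\theta+R\sin\theta|\,\log p, & \theta\in[0,\theta_L],\\ k\,|(R-L)\sin\theta|\,\log p, & \theta\in[\theta_L,\theta_R],\\ k\,|\cos\theta+L\sin\theta|\,\log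 p, & \theta\in[\theta_R,\pi].\end{cases}$$ -/

import Mathlib

open Filter Topology

/-- Bi-infinite configurations over the ring `ℤ/m`. -/
abbrev Config (m : ℕ) : Type := ℤ → ZMod m

/-- The neighbourhood `{-r, …, r}`. -/
abbrev Nbhd (r : ℕ) : Type := {j : ℤ // j ∈ Finset.Icc (-(r : ℤ)) (r : ℤ)}

/-- A local rule of radius `r`: a function of the variables `x_{-r}, …, x_r`. -/
abbrev LocalRule (m r : ℕ) : Type := (Nbhd r → ZMod m) → ZMod m

/-- The linear local rule `f(x_{-r}, …, x_r) = ∑ a_i x_i` over `ℤ/m`. -/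
noncomputable def linearRule {m r : ℕ} (a : Nbhd r → ZMod m) : LocalRule m r :=
  fun u => ∑ j, a j * u j

/-- The rule `f` is permutative in the variable `x_j`: for every choice of the other variables,
`x_j ↦ f(x_{-r}, …, x_r)` is a permutation of the alphabet. -/
def IsPermutativeIn {m r : ℕ} (f : LocalRule m r) (j : Nbhd r) : Prop :=
  ∀ u : Nbhd r → ZMod m, Function.Bijective fun s : ZMod m => f (Function.update u j s)

/-- The one-dimensional cellular automaton `(T x)_n = f(x_{n-r}, …, x_{n+r})`. -/
def cellularAutomaton {m r : ℕ} (f : LocalRule m r) : Config m → Config m :=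
  fun x n => f fun j => x (n + j)

/-- The power `σ^n` of the shift, `(σ^n x)_i = x_{i+n}`. -/
def shiftPow {m : ℕ} (n : ℤ) : Config m → Config m :=
  fun x i => x (i + n)

/-- The action `Φ^{(n,t)} = σ^n ∘ T^t` of `ℤ × ℤ₊` generated by the shift and `T`. -/
def shiftAction {m : ℕ} (T : Config m → Config m) (n : ℤ) (t : ℕ) : Config m → Config m :=
  fun x => shiftPow n (T^[t] x)

/-- The metric `d(x, y) = ∑_{i ∈ ℤ} |x_i - y_i| / m^{|i|}`, where residues are represented
by `0, …, m - 1`. (The series converges for `m ≥ 2`.) -/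
noncomputable def configDist {m : ℕ} (x y : Config m) : ℝ :=
  ∑' i : ℤ, |((x i).val : ℝ) - ((y i).val : ℝ)| / (m : ℝ) ^ i.natAbs

/-- The window
`W(w, τ, θ) = {(x + y cos θ, y sin θ) : -w < x < w, 0 < y ≤ τ}` in the space-time plane. -/
def window (w : ℕ) (τ θ : ℝ) : Set (ℝ × ℝ) :=
  {q | ∃ x y : ℝ, -(w : ℝ) < x ∧ x < w ∧ 0 < y ∧ y ≤ τ ∧
    q = (x + y * Real.cos θ, y * Real.sin θ)}

/-- `M` is `(ε, W)`-separated: any two distinct points of `M` have images at distance at least `ε`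
under `Φ^{(n,t)}` for some lattice point `(n, t)` of `W`. -/
def IsWindowSeparated {m : ℕ} (T : Config m → Config m) (ε : ℝ) (W : Set (ℝ × ℝ))
    (M : Set (Config m)) : Prop :=
  M.Pairwise fun x y => ∃ (n : ℤ) (t : ℕ), ((n : ℝ), (t : ℝ)) ∈ W ∧
    ε ≤ configDist (shiftAction T n t x) (shiftAction T n t y)

/-- `N(ε, W)`: the largest cardinality of an `(ε, W)`-separated set. -/
noncomputable def separatedNumber {m : ℕ} (T : Config m → Config m) (ε : ℝ)
    (W : Set (ℝ × ℝ)) : ℕ∞ :=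
  ⨆ (M : Set (Config m)) (_ : IsWindowSeparated T ε W M), M.encard

/-- `limsup_{w → ∞} limsup_{τ → ∞} (1/τ) log N(ε, W(w, τ, θ))`, as an extended real number. -/
noncomputable def directionalEntropyAtScale {m : ℕ} (T : Config m → Config m)
    (θ ε : ℝ) : EReal :=
  limsup (fun w : ℕ =>
    limsup (fun τ : ℝ =>
      ENNReal.log (separatedNumber T ε (window w τ θ) : ENNReal) / (τ : EReal)) atTop) atTop

/-- The topological directional entropy, in the direction `(cos θ, sin θ)`, of the action generated
by the shift and `T` exists (as a limit for `ε → 0+`) and equals `h`. -/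
def HasDirectionalEntropy {m : ℕ} (T : Config m → Config m) (θ h : ℝ) : Prop :=
  Tendsto (fun ε : ℝ => directionalEntropyAtScale T θ ε) (𝓝[>] 0) (𝓝 (h : EReal))

/-- The set `P = {0} ∪ {j : gcd(a_j, p) = 1}` of positions. -/
def unitPositions {m r : ℕ} (p : ℕ) (a : Nbhd r → ZMod m) : Set ℤ :=
  {0} ∪ {j : ℤ | ∃ i : Nbhd r, (i : ℤ) = j ∧ Nat.gcd (a i).val p = 1}

/-- The inverse cotangent with values in `(0, π)`. -/
noncomputable def arccot (x : ℝ) : ℝ := Real.pi / 2 - Real.arctan x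

/-!
In the direction `θ` the window is a thin strip leaving the origin, and what it sees of a
configuration is what flows into it: the automaton moves information at speeds between `L` and `R`,
so cells on the right flow in at rate `max 0 (cos θ + R sin θ)`, cells on the left at rate
`max 0 (-(cos θ + L sin θ))`.

Upper bound: write `T = B + p C`, where `B` keeps the coefficients in `[L, R]`. The operators
commute and `p ^ k = 0`, so the binomial expansion of `T ^ t` has fewer than `k` factors `C` in each
term; hence the neighbourhood of `T ^ t` is `[L t, R t]` up to a bounded error.

Lower bound: a set of configurations stable under multiplication by the nilpotent `p` is trivial
once its `p`-torsion is. On `p`-torsion only the unit coefficients act, so the extreme cells of a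
configuration move at exactly the speeds `L` and `R`: a configuration that is invisible in the strip
has no extreme cell in the region that flows into the strip.
-/

section Metric

variable {m : ℕ}

lemma summable_div_pow_natAbs (hm : 1 < m) (c : ℝ) :
    Summable fun i : ℤ => c / (m : ℝ) ^ i.natAbs := by
  have hm' : (1 : ℝ) < m := by exact_mod_cast hm
  have hgeom : Summable fun n : ℕ => c * (m : ℝ)⁻¹ ^ n :=
    (summable_geometric_of_lt_one (by positivity) (inv_lt_one_of_one_lt₀ hm')).mul_left c
  rw [summable_int_iff_summable_nat_and_neg]
  constructor <;> simpa [div_eq_mul_inv] using hgeom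

lemma abs_val_sub_val_le [NeZero m] (a b : ZMod m) : |(a.val : ℝ) - b.val| ≤ m :=
  abs_sub_le_of_nonneg_of_le (Nat.cast_nonneg _) (by exact_mod_cast (ZMod.val_lt a).le)
    (Nat.cast_nonneg _) (by exact_mod_cast (ZMod.val_lt b).le)

lemma configDist_term_le [NeZero m] (x y : Config m) (i : ℤ) :
    |((x i).val : ℝ) - (y i).val| / (m : ℝ) ^ i.natAbs ≤ m / (m : ℝ) ^ i.natAbs := by
  gcongr
  exact abs_val_sub_val_le _ _

lemma summable_configDist (hm : 1 < m) (x y : Config m) :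
    Summable fun i : ℤ => |((x i).val : ℝ) - (y i).val| / (m : ℝ) ^ i.natAbs :=
  have : NeZero m := ⟨by lia⟩
  (summable_div_pow_natAbs hm m).of_nonneg_of_le (fun _ => by positivity) (configDist_term_le x y)

lemma one_le_configDist (hm : 1 < m) {x y : Config m} (h : x 0 ≠ y 0) : 1 ≤ configDist x y := by
  have : NeZero m := ⟨by lia⟩
  have hval : ((x 0).val : ℤ) - (y 0).val ≠ 0 := fun h0 => h (ZMod.val_injective m (by lia))
  calc (1 : ℝ) ≤ |((x 0).val : ℝ) - (y 0).val| := by exact_mod_cast Int.one_le_abs hval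
    _ = |((x 0).val : ℝ) - (y 0).val| / (m : ℝ) ^ (0 : ℤ).natAbs := by simp
    _ ≤ configDist x y := (summable_configDist hm x y).le_tsum 0 fun _ _ => by positivity

lemma exists_configDist_lt (hm : 1 < m) {ε : ℝ} (hε : 0 < ε) :
    ∃ K : ℕ, ∀ x y : Config m, (∀ i : ℤ, i.natAbs ≤ K → x i = y i) → configDist x y < ε := by
  have : NeZero m := ⟨by lia⟩
  have htail := tendsto_tsum_compl_atTop_zero fun i : ℤ => (m : ℝ) / (m : ℝ) ^ i.natAbs
  obtain ⟨s, hs⟩ := ((tendsto_order.1 htail).2 ε hε).exists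
  refine ⟨s.sup Int.natAbs, fun x y hxy => lt_of_le_of_lt ?_ hs⟩
  have hsupp : Function.support
      (fun i : ℤ => |((x i).val : ℝ) - (y i).val| / (m : ℝ) ^ i.natAbs) ⊆ {i | i ∉ s} := by
    refine fun i hi his => hi ?_
    simp [hxy i (Finset.le_sup (f := Int.natAbs) his)]
  rw [configDist, ← tsum_subtype_eq_of_support_subset hsupp]
  exact Summable.tsum_le_tsum (fun i => configDist_term_le x y i)
    ((summable_configDist hm x y).subtype _) ((summable_div_pow_natAbs hm m).subtype _)

end Metric

section Counting

variable {m : ℕ} {T : Config m → Config m} {ε : ℝ} {W : Set (ℝ × ℝ)}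

lemma separatedNumber_le_of_agreeOn [NeZero m] (J : Finset ℤ)
    (h : ∀ x y : Config m, (∀ i ∈ J, x i = y i) → ∀ (n : ℤ) (t : ℕ), ((n : ℝ), (t : ℝ)) ∈ W →
      configDist (shiftAction T n t x) (shiftAction T n t y) < ε) :
    separatedNumber T ε W ≤ (m ^ J.card : ℕ) := by
  refine iSup₂_le fun M hM => ?_
  have hinj : Set.InjOn (fun (x : Config m) (i : J) => x i) M := fun x hx y hy hxy => by
    by_contra hne
    obtain ⟨n, t, hW, hd⟩ := hM hx hy hne
    exact hd.not_gt (h x y (fun i hi => congrFun hxy ⟨i, hi⟩) n t hW)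
  calc M.encard ≤ (Set.univ : Set (J → ZMod m)).encard :=
        Set.encard_le_encard_of_injOn (fun _ _ => Set.mem_univ _) hinj
    _ = (m ^ J.card : ℕ) := by
        rw [Set.encard_univ, ENat.card_eq_coe_fintype_card]
        simp [ZMod.card]

lemma le_separatedNumber_of_supportedOn (hm : 1 < m) (hε : ε ≤ 1) (J : Finset ℤ)
    (h : ∀ x y : Config m, (∀ i ∉ J, x i = 0) → (∀ i ∉ J, y i = 0) →
      (∀ (n : ℤ) (t : ℕ), ((n : ℝ), (t : ℝ)) ∈ W → T^[t] x n = T^[t] y n) → x = y) :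
    (m ^ J.card : ℕ) ≤ separatedNumber T ε W := by
  classical
  have : NeZero m := ⟨by lia⟩
  let extend : (J → ZMod m) → Config m := fun u i => if hi : i ∈ J then u ⟨i, hi⟩ else 0
  have hinj : Function.Injective extend := fun u v huv => by
    ext i
    simpa [extend] using congrFun huv i
  have hsep : IsWindowSeparated T ε W (Set.range extend) := by
    rintro _ ⟨u, rfl⟩ _ ⟨v, rfl⟩ hne
    contrapose! hne
    refine h _ _ (fun i hi => by simp [extend, hi]) (fun i hi => by simp [extend, hi])
      fun n t hW => ?_
    by_contra hnt
    exact (hne n t hW).not_ge (hε.trans (one_le_configDist hm (by simpa [shiftAction, shiftPow])))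
  calc ((m ^ J.card : ℕ) : ℕ∞) = ENat.card (J → ZMod m) := by
        rw [ENat.card_eq_coe_fintype_card]
        simp [ZMod.card]
    _ ≤ (Set.range extend).encard := hinj.encard_range
    _ ≤ separatedNumber T ε W := le_iSup₂_of_le (Set.range extend) hsep le_rfl

end Counting

section Growth

/-- `N τ ≥ m ^ (h τ - O(1))` as `τ → ∞`. -/
def GrowsAtLeast (m : ℕ) (N : ℝ → ℕ∞) (h : ℝ) : Prop :=
  ∃ C : ℝ, ∀ᶠ τ in atTop, ∃ n : ℕ, τ * h - C ≤ n ∧ (m ^ n : ℕ) ≤ N τ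

/-- `N τ ≤ m ^ (h τ + O(1))` as `τ → ∞`. -/
def GrowsAtMost (m : ℕ) (N : ℝ → ℕ∞) (h : ℝ) : Prop :=
  ∃ C : ℝ, ∀ᶠ τ in atTop, ∃ n : ℕ, n ≤ τ * h + C ∧ N τ ≤ (m ^ n : ℕ)

variable {m : ℕ} {h : ℝ}

lemma log_natCast_pow (hm : 0 < m) (n : ℕ) :
    ENNReal.log (((m ^ n : ℕ) : ℕ∞) : ENNReal) = ((n * Real.log m : ℝ) : EReal) := by
  rw [ENat.toENNReal_coe, ENNReal.log_pos_real (by simp; lia) (by simp)]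
  simp

lemma tendsto_linear_mul_div_atTop (h C b : ℝ) :
    Tendsto (fun τ : ℝ => (((τ * h + C) * b / τ : ℝ) : EReal)) atTop (𝓝 ((h * b : ℝ) : EReal)) := by
  have hlim : Tendsto (fun τ : ℝ => h * b + C * b * τ⁻¹) atTop (𝓝 (h * b + C * b * 0)) :=
    tendsto_const_nhds.add (tendsto_inv_atTop_zero.const_mul _)
  rw [mul_zero, add_zero] at hlim
  refine (continuous_coe_real_ereal.tendsto _).comp (hlim.congr' ?_)
  filter_upwards [eventually_gt_atTop 0] with τ hτ
  field_simp

lemma tendsto_log_div_of_growth (hm : 0 < m) {N : ℝ → ℕ∞} (lower : GrowsAtLeast m N h)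
    (upper : GrowsAtMost m N h) :
    Tendsto (fun τ : ℝ => ENNReal.log (N τ : ENNReal) / (τ : EReal)) atTop
      (𝓝 ((h * Real.log m : ℝ) : EReal)) := by
  obtain ⟨C, hC⟩ := lower
  obtain ⟨C', hC'⟩ := upper
  refine tendsto_of_tendsto_of_tendsto_of_le_of_le' (tendsto_linear_mul_div_atTop h (-C) _)
    (tendsto_linear_mul_div_atTop h C' _) ?_ ?_
  · filter_upwards [hC, eventually_gt_atTop 0] with τ ⟨n, hn, hN⟩ hτ
    have hlog := ENNReal.log_monotone (ENat.toENNReal_mono hN)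
    rw [log_natCast_pow hm] at hlog
    refine le_trans ?_ (EReal.div_le_div_right_of_nonneg (EReal.coe_nonneg.2 hτ.le) hlog)
    rw [← EReal.coe_div, EReal.coe_le_coe_iff]
    gcongr
    exact hn
  · filter_upwards [hC', eventually_gt_atTop 0] with τ ⟨n, hn, hN⟩ hτ
    have hlog := ENNReal.log_monotone (ENat.toENNReal_mono hN)
    rw [log_natCast_pow hm] at hlog
    refine (EReal.div_le_div_right_of_nonneg (EReal.coe_nonneg.2 hτ.le) hlog).trans ?_
    rw [← EReal.coe_div, EReal.coe_le_coe_iff]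
    gcongr

lemma hasDirectionalEntropy_of_growth (hm : 0 < m) {T : Config m → Config m} {θ : ℝ}
    (lower : ∀ᶠ ε in 𝓝[>] 0, ∀ᶠ w : ℕ in atTop,
      GrowsAtLeast m (fun τ => separatedNumber T ε (window w τ θ)) h)
    (upper : ∀ᶠ ε in 𝓝[>] 0, ∀ᶠ w : ℕ in atTop,
      GrowsAtMost m (fun τ => separatedNumber T ε (window w τ θ)) h) :
    HasDirectionalEntropy T θ (h * Real.log m) := by
  refine tendsto_const_nhds.congr' ?_
  filter_upwards [lower, upper] with ε hlower hupper
  refine (Tendsto.limsup_eq (tendsto_const_nhds.congr' ?_)).symm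
  filter_upwards [hlower, hupper] with w hw hw'
  exact (tendsto_log_div_of_growth hm hw hw').limsup_eq.symm

end Growth

section Neighborhood

variable {A : Type*} [CommRing A]

/-- The linear map `F` on bi-infinite sequences has the neighbourhood `[L, R]`, that is, `(F z) n`
depends only on the cells `n + L, …, n + R` of `z`. -/
def HasNeighborhood (F : Module.End A (ℤ → A)) (L R : ℤ) : Prop :=
  ∀ ⦃z : ℤ → A⦄ ⦃n : ℤ⦄, (∀ i ∈ Set.Icc (n + L) (n + R), z i = 0) → F z n = 0

namespace HasNeighborhood

variable {F G : Module.End A (ℤ → A)} {L R L' R' : ℤ}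

lemma apply_eq (hF : HasNeighborhood F L R) {x y : ℤ → A} {n : ℤ}
    (h : ∀ i ∈ Set.Icc (n + L) (n + R), x i = y i) : F x n = F y n := by
  rw [← sub_eq_zero, ← Pi.sub_apply, ← map_sub]
  exact hF fun i hi => sub_eq_zero.2 (h i hi)

lemma mono (hF : HasNeighborhood F L R) (hL : L' ≤ L) (hR : R ≤ R') : HasNeighborhood F L' R' :=
  fun _ _ h => hF fun i hi => h i ⟨by linarith [hi.1], by linarith [hi.2]⟩

lemma natCast (c : ℕ) : HasNeighborhood (c : Module.End A (ℤ → A)) 0 0 := fun z n h => by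
  simp [h n (by simp)]

lemma smul (hF : HasNeighborhood F L R) (c : A) : HasNeighborhood (c • F) L R :=
  fun z n h => by simp [hF h]

lemma sum {ι : Type*} {s : Finset ι} {f : ι → Module.End A (ℤ → A)}
    (hf : ∀ i ∈ s, HasNeighborhood (f i) L R) : HasNeighborhood (∑ i ∈ s, f i) L R :=
  fun z n h => by
    rw [LinearMap.sum_apply, Finset.sum_apply]
    exact Finset.sum_eq_zero fun i hi => hf i hi h

lemma mul (hF : HasNeighborhood F L R) (hG : HasNeighborhood G L' R') :
    HasNeighborhood (F * G) (L + L') (R + R') := fun _ _ h =>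
  hF fun _ hi => hG fun l hl => h l ⟨by linarith [hi.1, hl.1], by linarith [hi.2, hl.2]⟩

lemma pow (hF : HasNeighborhood F L R) (t : ℕ) : HasNeighborhood (F ^ t) (L * t) (R * t) := by
  induction t with
  | zero => simpa using natCast (A := A) 1
  | succ t ih => simpa [pow_succ, mul_add] using ih.mul hF

/-- The terms of the binomial expansion of `(F + q G) ^ t` with `k` or more factors `q G` vanish,
and each of the other factors `G` in place of `F` widens the neighbourhood by at most `2 r`. -/
lemma pow_add_smul {r : ℤ} (hF : HasNeighborhood F L R) (hG : HasNeighborhood G (-r) r)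
    (hFG : Commute F G) {q : A} {k : ℕ} (hq : q ^ k = 0) (hL : |L| ≤ r) (hR : |R| ≤ r) (t : ℕ) :
    HasNeighborhood ((F + q • G) ^ t) (L * t - 2 * r * k) (R * t + 2 * r * k) := by
  rw [add_comm, (hFG.smul_right q).symm.add_pow]
  refine sum fun e he => ?_
  obtain hke | hek := le_or_gt k e
  · intro z n _
    simp [smul_pow, pow_eq_zero_of_le hke hq]
  obtain ⟨s, rfl⟩ := Nat.exists_eq_add_of_le (Finset.mem_range_succ_iff.1 he)
  rw [smul_pow, Nat.add_sub_cancel_left]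
  refine (((hG.pow e).smul (q ^ e)).mul (hF.pow s) |>.mul (natCast _)).mono ?_ ?_
  all_goals
    have hLr := (le_abs_self L).trans hL
    have hRr := (neg_abs_le R).trans' (neg_le_neg hR)
    have hr : 0 ≤ r := (abs_nonneg L).trans hL
    have hek' : (e : ℤ) ≤ k := by exact_mod_cast hek.le
    push_cast
    nlinarith [mul_le_mul_of_nonneg_left hek' hr, mul_le_mul_of_nonneg_right hLr e.cast_nonneg,
      mul_le_mul_of_nonneg_right hRr e.cast_nonneg]

end HasNeighborhood

end Neighborhood

section LinearAutomaton

variable {m r : ℕ}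

/-- The cellular automaton of the linear rule with coefficients `a`, as a linear map. -/
noncomputable def linearAutomaton (a : Nbhd r → ZMod m) : Module.End (ZMod m) (Config m) where
  toFun := cellularAutomaton (linearRule a)
  map_add' x y := by
    ext n
    simp [cellularAutomaton, linearRule, mul_add, Finset.sum_add_distrib]
  map_smul' c x := by
    ext n
    simp [cellularAutomaton, linearRule, Finset.mul_sum, mul_left_comm]

lemma linearAutomaton_apply (a : Nbhd r → ZMod m) (x : Config m) (n : ℤ) :
    linearAutomaton a x n = ∑ j : Nbhd r, a j * x (n + j) := rfl

lemma iterate_cellularAutomaton_linearRule (a : Nbhd r → ZMod m) (t : ℕ) :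
    (cellularAutomaton (linearRule a))^[t] = ⇑(linearAutomaton a ^ t) :=
  (Module.End.coe_pow (linearAutomaton a) t).symm

lemma linearAutomaton_add_smul (b c : Nbhd r → ZMod m) (q : ZMod m) :
    linearAutomaton (b + q • c) = linearAutomaton b + q • linearAutomaton c := by
  ext x n
  simp [linearAutomaton_apply, add_mul, mul_assoc, Finset.sum_add_distrib, Finset.mul_sum]

lemma commute_linearAutomaton (b c : Nbhd r → ZMod m) :
    Commute (linearAutomaton b) (linearAutomaton c) := by
  ext x n
  simp only [Module.End.mul_apply, linearAutomaton_apply, Finset.mul_sum]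
  rw [Finset.sum_comm]
  refine Finset.sum_congr rfl fun i _ => Finset.sum_congr rfl fun j _ => ?_
  rw [mul_left_comm, add_right_comm]

lemma hasNeighborhood_linearAutomaton {b : Nbhd r → ZMod m} {L R : ℤ}
    (hb : ∀ j : Nbhd r, (j : ℤ) ∉ Set.Icc L R → b j = 0) :
    HasNeighborhood (linearAutomaton b) L R := fun z n h => by
  rw [linearAutomaton_apply]
  refine Finset.sum_eq_zero fun j _ => ?_
  by_cases hj : (j : ℤ) ∈ Set.Icc L R
  · rw [h (n + j) ⟨by linarith [hj.1], by linarith [hj.2]⟩, mul_zero]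
  · rw [hb j hj, zero_mul]

lemma hasNeighborhood_linearAutomaton_pow {a : Nbhd r → ZMod m} {q : ZMod m} {k : ℕ}
    (hq : q ^ k = 0) {L R : ℤ} (hL : |L| ≤ r) (hR : |R| ≤ r)
    (ha : ∀ j : Nbhd r, (j : ℤ) ∉ Set.Icc L R → q ∣ a j) (t : ℕ) :
    HasNeighborhood (linearAutomaton a ^ t) (L * t - 2 * r * k) (R * t + 2 * r * k) := by
  have hsplit : ∀ j, ∃ b c, a j = b + q * c ∧ ((j : ℤ) ∉ Set.Icc L R → b = 0) := fun j => by
    by_cases hj : (j : ℤ) ∈ Set.Icc L R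
    · exact ⟨a j, 0, by simp, fun h => absurd hj h⟩
    · obtain ⟨c, hc⟩ := ha j hj
      exact ⟨0, c, by simp [hc], fun _ => rfl⟩
  choose b c habc hb using hsplit
  have hc : HasNeighborhood (linearAutomaton c) (-r) r :=
    hasNeighborhood_linearAutomaton fun j hj => absurd (Finset.mem_Icc.1 j.2) hj
  rw [show a = b + q • c from funext habc, linearAutomaton_add_smul]
  exact (hasNeighborhood_linearAutomaton hb).pow_add_smul hc (commute_linearAutomaton b c) hq
    hL hR t

end LinearAutomaton

section Units

variable {m r p k : ℕ}

/-- The positions of the invertible coefficients of a linear rule; unlike `unitPositions` it does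
not contain `0` by convention. -/
def unitSupport (a : Nbhd r → ZMod m) : Set ℤ := (↑) '' {j : Nbhd r | IsUnit (a j)}

lemma abs_le_of_mem_unitSupport {a : Nbhd r → ZMod m} {i : ℤ} (hi : i ∈ unitSupport a) :
    |i| ≤ r := by
  obtain ⟨j, -, rfl⟩ := hi
  exact abs_le.2 (Finset.mem_Icc.1 j.2)

lemma not_isUnit_of_notMem_Icc {a : Nbhd r → ZMod m} {L R : ℤ}
    (hL : L ∈ lowerBounds (unitSupport a)) (hR : R ∈ upperBounds (unitSupport a)) {j : Nbhd r}
    (hj : (j : ℤ) ∉ Set.Icc L R) : ¬ IsUnit (a j) := fun hu =>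
  hj ⟨hL (Set.mem_image_of_mem _ hu), hR (Set.mem_image_of_mem _ hu)⟩

lemma isUnit_of_isPermutativeIn {a : Nbhd r → ZMod m} {i : Nbhd r}
    (h : IsPermutativeIn (linearRule a) i) : IsUnit (a i) := by
  obtain ⟨s, hs⟩ := (h 0).surjective 1
  refine IsUnit.of_mul_eq_one s ?_
  simpa [linearRule, Function.update_apply] using hs

lemma isUnit_iff_gcd_val_eq_one (hp : p.Prime) (hk : 1 ≤ k) (b : ZMod (p ^ k)) :
    IsUnit b ↔ Nat.gcd b.val p = 1 := by
  have : NeZero (p ^ k) := ⟨(pow_pos hp.pos k).ne'⟩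
  conv_lhs => rw [← ZMod.natCast_zmod_val b]
  rw [ZMod.isUnit_iff_coprime, Nat.coprime_pow_right_iff hk, Nat.coprime_iff_gcd_eq_one]

lemma unitPositions_eq_insert (hp : p.Prime) (hk : 1 ≤ k) (a : Nbhd r → ZMod (p ^ k)) :
    unitPositions p a = insert 0 (unitSupport a) := by
  ext i
  simp only [unitPositions, unitSupport, isUnit_iff_gcd_val_eq_one hp hk, Set.mem_insert_iff,
    Set.mem_union, Set.mem_singleton_iff, Set.mem_ofPred_eq, Set.mem_image, and_comm]

lemma isLeast_of_isLeast_insert {α : Type*} [Preorder α] {s : Set α} {b c d : α}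
    (hb : IsLeast (insert c s) b) (hd : d ∈ s) (hdc : d < c) : IsLeast s b :=
  have hbc : b < c := (hb.2 (Set.mem_insert_of_mem c hd)).trans_lt hdc
  ⟨hb.1.resolve_left hbc.ne, fun _ hi => hb.2 (Set.mem_insert_of_mem c hi)⟩

lemma natCast_prime_pow_eq_zero (p k : ℕ) : (p : ZMod (p ^ k)) ^ k = 0 := by
  exact_mod_cast ZMod.natCast_self (p ^ k)

lemma dvd_of_not_isUnit (hp : p.Prime) {b : ZMod (p ^ k)} (hb : ¬ IsUnit b) :
    (p : ZMod (p ^ k)) ∣ b := by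
  have : NeZero (p ^ k) := ⟨(pow_pos hp.pos k).ne'⟩
  rw [← ZMod.natCast_zmod_val b] at hb ⊢
  rw [ZMod.isUnit_iff_coprime] at hb
  refine Nat.cast_dvd_cast ((hp.dvd_iff_not_coprime).2 fun hcop => hb ?_)
  exact hcop.symm.pow_right k

end Units


section Torsion

lemma eq_zero_of_isNilpotent {A M : Type*} [MonoidWithZero A] [Zero M] [MulActionWithZero A M]
    {q : A} (hq : IsNilpotent q) {s : Set M} (hs : ∀ z ∈ s, q • z ∈ s)
    (h : ∀ z ∈ s, q • z = 0 → z = 0) {z : M} (hz : z ∈ s) : z = 0 := by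
  obtain ⟨e, he⟩ := hq
  have htorsion : q ^ e • z = 0 := by rw [he, zero_smul]
  clear he
  induction e generalizing z with
  | zero => rwa [pow_zero, one_smul] at htorsion
  | succ e ih => exact h z hz (ih (hs z hz) (by rwa [← mul_smul, ← pow_succ]))

variable {p k r : ℕ} {a : Nbhd r → ZMod (p ^ k)} {L R n : ℤ} {z : Config (p ^ k)}

lemma eq_zero_of_linearAutomaton_apply_eq_zero (hp : p.Prime) (hz : (p : ZMod (p ^ k)) • z = 0)
    {j : Nbhd r} (hj : IsUnit (a j)) (h : ∀ i ≠ j, IsUnit (a i) → z (n + i) = 0)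
    (hn : linearAutomaton a z n = 0) : z (n + j) = 0 := by
  rw [linearAutomaton_apply, Finset.sum_eq_single j _ (by simp)] at hn
  · exact hj.mul_right_eq_zero.1 hn
  intro i _ hij
  by_cases hi : IsUnit (a i)
  · rw [h i hij hi, mul_zero]
  · obtain ⟨b, hb⟩ := dvd_of_not_isUnit hp hi
    have hpz : (p : ZMod (p ^ k)) * z (n + i) = 0 := congrFun hz (n + i)
    rw [hb, mul_right_comm, hpz, zero_mul]

lemma apply_add_greatest_eq_zero (hp : p.Prime) (hL : L ∈ lowerBounds (unitSupport a))
    (hR : IsGreatest (unitSupport a) R) (hz : (p : ZMod (p ^ k)) • z = 0)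
    (hn : linearAutomaton a z n = 0) (h : ∀ i ∈ Set.Ico (n + L) (n + R), z i = 0) :
    z (n + R) = 0 := by
  obtain ⟨⟨j, hj, rfl⟩, hmax⟩ := hR
  refine eq_zero_of_linearAutomaton_apply_eq_zero hp hz hj (fun i hij hi => h _ ?_) hn
  have hLi := hL (Set.mem_image_of_mem _ hi)
  have hij' := (hmax (Set.mem_image_of_mem _ hi)).lt_of_ne (Subtype.coe_injective.ne hij)
  constructor <;> linarith

lemma apply_add_least_eq_zero (hp : p.Prime) (hL : IsLeast (unitSupport a) L)
    (hR : R ∈ upperBounds (unitSupport a)) (hz : (p : ZMod (p ^ k)) • z = 0)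
    (hn : linearAutomaton a z n = 0) (h : ∀ i ∈ Set.Ioc (n + L) (n + R), z i = 0) :
    z (n + L) = 0 := by
  obtain ⟨⟨j, hj, rfl⟩, hmin⟩ := hL
  refine eq_zero_of_linearAutomaton_apply_eq_zero hp hz hj (fun i hij hi => h _ ?_) hn
  have hRi := hR (Set.mem_image_of_mem _ hi)
  have hij' := (hmin (Set.mem_image_of_mem _ hi)).lt_of_ne (Subtype.coe_injective.ne hij.symm)
  constructor <;> linarith

end Torsion

section Propagation

variable {A : Type*} [Zero A] {L R : ℤ} {v w : ℝ}

/-- The first nonzero cell to the right of the strip moves at speed `-R`, so it would enter the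
strip if it started in the region below. -/
lemma eq_zero_right_of_strip (hLR : (R : ℝ) - L < 2 * w) (hR : v + R < 2 * w) {τ : ℕ}
    {y : ℕ → ℤ → A} {c : ℝ}
    (hedge : ∀ t n, y (t + 1) n = 0 → (∀ i ∈ Set.Ico (n + L) (n + R), y t i = 0) → y t (n + R) = 0)
    (hstrip : ∀ t ≤ τ, ∀ n : ℤ, |n - (c + t * v)| < w → y t n = 0) {n : ℤ} (hn : c - w < n)
    (hn' : n < c + w + τ * max 0 (v + R)) : y 0 n = 0 := by
  induction τ generalizing y c n with
  | zero => exact hstrip 0 le_rfl n (abs_lt.2 (by constructor <;> norm_num at hn' ⊢ <;> linarith))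
  | succ τ ih =>
    by_contra hne
    obtain ⟨e, ⟨hce, he⟩, hmin⟩ := Int.exists_least_of_bdd
      (P := fun i : ℤ => c - w < i ∧ y 0 i ≠ 0)
      ⟨⌊c - w⌋, fun i hi => Int.floor_le_iff.2 (by linarith [hi.1])⟩ ⟨n, hn, hne⟩
    have hen : (e : ℝ) ≤ n := by exact_mod_cast hmin n ⟨hn, hne⟩
    have hwe : c + w ≤ e := by
      by_contra! hlt
      exact he (hstrip 0 (Nat.zero_le _) e (abs_lt.2 (by constructor <;> norm_num <;> linarith)))
    have hpos : 0 < v + R := by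
      by_contra! hnonpos
      rw [max_eq_left hnonpos] at hn'
      linarith
    rw [max_eq_right hpos.le] at hn' ih
    push_cast at hn'
    refine he ?_
    rw [← sub_add_cancel e R]
    refine hedge 0 (e - R) ?_ fun i hi => ?_
    · refine ih (y := fun t => y (t + 1)) (c := c + v) (fun t => hedge (t + 1)) ?_ ?_ ?_
      · refine fun t ht n hn => hstrip (t + 1) (by lia) n ?_
        convert hn using 3
        push_cast
        ring
      all_goals
        push_cast
        linarith
    · have hie : i < e := by simpa using hi.2
      have hei : (e : ℝ) - R + L ≤ i := by exact_mod_cast hi.1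
      by_contra hyi
      exact hie.not_ge (hmin i ⟨by linarith, hyi⟩)

lemma eq_zero_left_of_strip (hLR : (R : ℝ) - L < 2 * w) (hL : -(v + L) < 2 * w) {τ : ℕ}
    {y : ℕ → ℤ → A} {c : ℝ}
    (hedge : ∀ t n, y (t + 1) n = 0 → (∀ i ∈ Set.Ioc (n + L) (n + R), y t i = 0) → y t (n + L) = 0)
    (hstrip : ∀ t ≤ τ, ∀ n : ℤ, |n - (c + t * v)| < w → y t n = 0) {n : ℤ}
    (hn : c - w - τ * max 0 (-(v + L)) < n) (hn' : n < c + w) : y 0 n = 0 := by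
  have hspeed : -v + ((-L : ℤ) : ℝ) = -(v + L) := by push_cast; ring
  have hreflect := eq_zero_right_of_strip (y := fun t i => y t (-i)) (L := -R) (R := -L) (v := -v)
    (w := w) (τ := τ) (c := -c) (n := -n) (by push_cast; linarith) (by linarith)
    (fun t n hn h => ?_) (fun t ht n hn => hstrip t ht _ ?_) (by push_cast; linarith)
    (by rw [hspeed]; push_cast; linarith)
  · simpa using hreflect
  · have hedge' := hedge t (-n) hn fun i hi => by
      simpa using h (-i) ⟨by linarith [hi.2], by linarith [hi.1]⟩
    rwa [neg_add, neg_neg]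
  · rw [← abs_neg]
    convert hn using 2
    push_cast
    ring

end Propagation

section Strip

variable {p k r : ℕ} {a : Nbhd r → ZMod (p ^ k)} {L R : ℤ} {v w : ℝ} {τ : ℕ} {z : Config (p ^ k)}

lemma linearAutomaton_apply_eq_zero_of_strip (hp : p.Prime) (hL : IsLeast (unitSupport a) L)
    (hR : IsGreatest (unitSupport a) R) (hw : |v| + |(L : ℝ)| + |(R : ℝ)| < w)
    (hz : (p : ZMod (p ^ k)) • z = 0)
    (hstrip : ∀ t ≤ τ, ∀ n : ℤ, |n - (t + 1) * v| < w → (linearAutomaton a ^ (t + 1)) z n = 0)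
    {n : ℤ} (hn : v - w - τ * max 0 (-(v + L)) < n) (hn' : n < v + w + τ * max 0 (v + R)) :
    linearAutomaton a z n = 0 := by
  have hv := abs_nonneg v
  obtain ⟨hv₁, hv₂⟩ := abs_le.1 (le_refl |v|)
  obtain ⟨hL₁, hL₂⟩ := abs_le.1 (le_refl |(L : ℝ)|)
  obtain ⟨hR₁, hR₂⟩ := abs_le.1 (le_refl |(R : ℝ)|)
  have htorsion (t : ℕ) : (p : ZMod (p ^ k)) • (linearAutomaton a ^ t) z = 0 := by
    rw [← map_smul, hz, map_zero]
  have hstrip' : ∀ t ≤ τ, ∀ n : ℤ, |n - (v + t * v)| < w →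
      (linearAutomaton a ^ (t + 1)) z n = 0 := fun t ht n hn => hstrip t ht n (by
    rwa [show (t + 1) * v = v + t * v by ring])
  rw [← pow_one (linearAutomaton a)]
  rcases lt_or_ge (v - w) n with h | h
  · refine eq_zero_right_of_strip (L := L) (R := R) (y := fun t => (linearAutomaton a ^ (t + 1)) z)
      (by linarith) (by linarith) (fun t i hi => ?_) hstrip' h hn'
    rw [pow_succ' _ (t + 1)] at hi
    exact apply_add_greatest_eq_zero hp hL.2 hR (htorsion _) hi
  · refine eq_zero_left_of_strip (L := L) (R := R) (y := fun t => (linearAutomaton a ^ (t + 1)) z)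
      (by linarith) (by linarith) (fun t i hi => ?_) hstrip' hn (by linarith)
    rw [pow_succ' _ (t + 1)] at hi
    exact apply_add_least_eq_zero hp hL hR.2 (htorsion _) hi

lemma eq_zero_of_strip (hp : p.Prime) (hL : IsLeast (unitSupport a) L)
    (hR : IsGreatest (unitSupport a) R) (hw : 2 * (|v| + |(L : ℝ)| + |(R : ℝ)|) < w)
    (hz : (p : ZMod (p ^ k)) • z = 0)
    (hsupp : ∀ i : ℤ, z i ≠ 0 →
      -((τ + 1) * max 0 (-(v + L))) ≤ i ∧ i ≤ (τ + 1) * max 0 (v + R))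
    (hstrip : ∀ t ≤ τ, ∀ n : ℤ, |n - (t + 1) * v| < w → (linearAutomaton a ^ (t + 1)) z n = 0) :
    z = 0 := by
  obtain ⟨hv, hv'⟩ := abs_le.1 (le_refl |v|)
  obtain ⟨hL₁, hL₂⟩ := abs_le.1 (le_refl |(L : ℝ)|)
  obtain ⟨hR₁, hR₂⟩ := abs_le.1 (le_refl |(R : ℝ)|)
  have hα : max 0 (-(v + L)) ≤ |v| + |(L : ℝ)| := max_le (by positivity) (by linarith)
  have hβ : max 0 (v + R) ≤ |v| + |(R : ℝ)| := max_le (by positivity) (by linarith)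
  by_contra hne
  obtain ⟨i, hi⟩ := Function.ne_iff.1 hne
  obtain ⟨e, he, hmin⟩ := Int.exists_least_of_bdd (P := fun i : ℤ => z i ≠ 0)
    ⟨⌊-((τ + 1) * max 0 (-(v + L)))⌋, fun i hi =>
      Int.cast_le.1 ((Int.floor_le _).trans (hsupp i hi).1)⟩ ⟨i, hi⟩
  obtain ⟨he₁, he₂⟩ := hsupp e he
  refine he ?_
  rw [← sub_add_cancel e R]
  refine apply_add_greatest_eq_zero hp hL.2 hR hz
    (linearAutomaton_apply_eq_zero_of_strip hp hL hR (by linarith [abs_nonneg v]) hz hstrip ?_ ?_)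
    fun i hi => ?_
  · push_cast
    linarith
  · push_cast
    linarith
  · by_contra hzi
    linarith [hmin i hzi, hi.2]

end Strip

section Directions

open Real

/-- The rate at which new cells become visible in a strip in the direction `θ`, when the
neighbourhood of the automaton is `[L, R]`: the sum of the rates on the right and on the left. -/
noncomputable def coneGrowth (L R θ : ℝ) : ℝ :=
  max 0 (cos θ + R * sin θ) + max 0 (-(cos θ + L * sin θ))

lemma coneGrowth_eq_sin_mul (L R : ℝ) {θ : ℝ} (hθ : 0 < sin θ) :
    coneGrowth L R θ = sin θ * (max 0 (cot θ + R) + max 0 (-(cot θ + L))) := by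
  rw [coneGrowth, mul_add, mul_max_of_nonneg _ _ hθ.le, mul_max_of_nonneg _ _ hθ.le, mul_zero,
    cot_eq_cos_div_sin]
  field_simp

lemma cos_add_mul_sin_eq (x θ : ℝ) :
    cos θ + x * sin θ = cos (θ - arctan x) / cos (arctan x) := by
  have hcos := (cos_arctan_pos x).ne'
  have hsin : sin (arctan x) = x * cos (arctan x) := by rw [← tan_mul_cos hcos, tan_arctan]
  rw [cos_sub, hsin]
  field_simp

lemma arccot_mem_Ioo (x : ℝ) : arccot x ∈ Set.Ioo 0 π := by
  rw [arccot]
  constructor <;> linarith [arctan_lt_pi_div_two x, neg_pi_div_two_lt_arctan x]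

lemma cos_add_mul_sin_nonneg {x θ : ℝ} (hθ : θ ∈ Set.Icc 0 (arccot (-x))) :
    0 ≤ cos θ + x * sin θ := by
  obtain ⟨h0, h⟩ := hθ
  rw [arccot, arctan_neg] at h
  rw [cos_add_mul_sin_eq]
  exact div_nonneg (cos_nonneg_of_neg_pi_div_two_le_of_le
    (by linarith [arctan_lt_pi_div_two x]) (by linarith)) (cos_arctan_pos x).le

lemma cos_add_mul_sin_nonpos {x θ : ℝ} (hθ : θ ∈ Set.Icc (arccot (-x)) π) :
    cos θ + x * sin θ ≤ 0 := by
  obtain ⟨h, hπ⟩ := hθ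
  rw [arccot, arctan_neg] at h
  rw [cos_add_mul_sin_eq]
  exact div_nonpos_of_nonpos_of_nonneg (cos_nonpos_of_pi_div_two_le_of_le
    (by linarith) (by linarith [neg_pi_div_two_lt_arctan x])) (cos_arctan_pos x).le

variable {L R θ : ℝ}

lemma coneGrowth_of_le_arccot (hLR : L ≤ R) (hθ : θ ∈ Set.Icc 0 (arccot (-L))) :
    coneGrowth L R θ = |cos θ + R * sin θ| := by
  have hsin := sin_nonneg_of_mem_Icc ⟨hθ.1, hθ.2.trans (arccot_mem_Ioo _).2.le⟩
  have hL := cos_add_mul_sin_nonneg hθ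
  have hR : 0 ≤ cos θ + R * sin θ := hL.trans (by gcongr)
  rw [coneGrowth, max_eq_right hR, max_eq_left (by linarith), abs_of_nonneg hR, add_zero]

lemma coneGrowth_of_mem_Icc_arccot (hLR : L ≤ R)
    (hθ : θ ∈ Set.Icc (arccot (-L)) (arccot (-R))) :
    coneGrowth L R θ = |(R - L) * sin θ| := by
  have hsin := sin_nonneg_of_mem_Icc
    ⟨(arccot_mem_Ioo _).1.le.trans hθ.1, hθ.2.trans (arccot_mem_Ioo _).2.le⟩
  have hL := cos_add_mul_sin_nonpos ⟨hθ.1, hθ.2.trans (arccot_mem_Ioo _).2.le⟩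
  have hR := cos_add_mul_sin_nonneg ⟨(arccot_mem_Ioo _).1.le.trans hθ.1, hθ.2⟩
  rw [coneGrowth, max_eq_right hR, max_eq_right (by linarith),
    abs_of_nonneg (mul_nonneg (sub_nonneg.2 hLR) hsin)]
  ring

lemma coneGrowth_of_arccot_le (hLR : L ≤ R) (hθ : θ ∈ Set.Icc (arccot (-R)) π) :
    coneGrowth L R θ = |cos θ + L * sin θ| := by
  have hsin := sin_nonneg_of_mem_Icc ⟨(arccot_mem_Ioo _).1.le.trans hθ.1, hθ.2⟩
  have hR := cos_add_mul_sin_nonpos hθ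
  have hL : cos θ + L * sin θ ≤ 0 := le_trans (by gcongr) hR
  rw [coneGrowth, max_eq_left hR, max_eq_right (by linarith), abs_of_nonpos hL, zero_add]

lemma mul_le_mul_max_zero {α : Type*} [Semiring α] [LinearOrder α] [IsOrderedRing α] {y τ c : α}
    (hy : 0 ≤ y) (hyτ : y ≤ τ) : y * c ≤ τ * max 0 c :=
  calc y * c ≤ y * max 0 c := by gcongr; exact le_max_right _ _
    _ ≤ τ * max 0 c := by gcongr

lemma add_mul_le_of_mem_window {w : ℕ} {τ n t : ℝ} (h : (n, t) ∈ window w τ θ) (c : ℝ) :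
    n + c * t ≤ w + τ * max 0 (cos θ + c * sin θ) := by
  obtain ⟨x, y, -, hx, hy, hyτ, hnt⟩ := h
  obtain ⟨rfl, rfl⟩ := Prod.mk.inj hnt
  linarith [mul_le_mul_max_zero (c := cos θ + c * sin θ) hy.le hyτ]

lemma neg_le_add_mul_of_mem_window {w : ℕ} {τ n t : ℝ} (h : (n, t) ∈ window w τ θ) (c : ℝ) :
    -(w + τ * max 0 (-(cos θ + c * sin θ))) ≤ n + c * t := by
  obtain ⟨x, y, hx, -, hy, hyτ, hnt⟩ := h
  obtain ⟨rfl, rfl⟩ := Prod.mk.inj hnt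
  linarith [mul_le_mul_max_zero (c := -(cos θ + c * sin θ)) hy.le hyτ]

lemma mem_window_iff_of_sin_pos (hθ : 0 < sin θ) {w : ℕ} {τ n t : ℝ} :
    (n, t) ∈ window w τ θ ↔ |n - t * cot θ| < w ∧ 0 < t ∧ t ≤ τ * sin θ := by
  have hcot : sin θ * cot θ = cos θ := by rw [cot_eq_cos_div_sin]; field_simp
  rw [abs_lt]
  constructor
  · rintro ⟨x, y, hx, hx', hy, hy', hnt⟩
    obtain ⟨rfl, rfl⟩ := Prod.mk.inj hnt
    rw [mul_assoc, hcot, add_sub_cancel_right]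
    exact ⟨⟨hx, hx'⟩, by positivity, by gcongr⟩
  · rintro ⟨⟨hx, hx'⟩, ht, ht'⟩
    refine ⟨n - t * cot θ, t / sin θ, hx, hx', by positivity, (div_le_iff₀ hθ).2 ht', ?_⟩
    rw [← hcot]
    field_simp
    simp

lemma mem_window_zero_of_sin_eq_zero (hθ : sin θ = 0) {w : ℕ} (hw : 1 < w) {τ n : ℝ} (hτ : 1 ≤ τ)
    (hn : -(τ * max 0 (-cos θ)) ≤ n) (hn' : n ≤ τ * max 0 (cos θ)) : (n, 0) ∈ window w τ θ := by
  have hw' : (1 : ℝ) < w := by exact_mod_cast hw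
  rcases sin_eq_zero_iff_cos_eq.1 hθ with hcos | hcos <;> rw [hcos] at hn hn' <;> norm_num at hn hn'
  · refine ⟨n - max n 1, max n 1, ?_, ?_, by simp, max_le hn' hτ, by simp [hθ, hcos]⟩
    · rcases max_cases n 1 with h | h <;> linarith
    · linarith [le_max_left n 1]
  · refine ⟨n + max (-n) 1, max (-n) 1, ?_, ?_, by simp, max_le (by linarith) hτ,
      by simp [hθ, hcos]⟩
    · linarith [le_max_left (-n) 1]
    · rcases max_cases (-n) 1 with h | h <;> linarith

end Directions

section IntegerIntervals

variable {α : Type*} [CommRing α] [LinearOrder α] [FloorRing α]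

lemma mem_Icc_ceil_floor {a b : α} {i : ℤ} : i ∈ Finset.Icc ⌈a⌉ ⌊b⌋ ↔ a ≤ i ∧ i ≤ b := by
  rw [Finset.mem_Icc, Int.ceil_le, Int.le_floor]

variable [IsStrictOrderedRing α]

lemma card_Icc_ceil_floor_le {a b : α} (hab : a ≤ b) :
    ((Finset.Icc ⌈a⌉ ⌊b⌋).card : α) ≤ b - a + 1 := by
  rw [Int.card_Icc, ← Int.cast_natCast, Int.toNat_eq_max, Int.cast_max]
  push_cast
  exact max_le (by linarith [Int.floor_le b, Int.le_ceil a]) (by linarith)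

lemma le_card_Icc_ceil_floor (a b : α) : b - a - 1 ≤ ((Finset.Icc ⌈a⌉ ⌊b⌋).card : α) := by
  rw [Int.card_Icc, ← Int.cast_natCast]
  refine le_trans ?_ (Int.cast_le.2 (Int.self_le_toNat _))
  push_cast
  linarith [Int.lt_floor_add_one b, Int.ceil_lt_add_one a]

end IntegerIntervals

section Entropy

lemma growsAtLeast_of_sin_eq_zero {m : ℕ} (hm : 1 < m) (T : Config m → Config m) (L R : ℝ)
    {ε θ : ℝ} (hε : ε ≤ 1) (hθ : Real.sin θ = 0) {w : ℕ} (hw : 1 < w) :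
    GrowsAtLeast m (fun τ => separatedNumber T ε (window w τ θ)) (coneGrowth L R θ) := by
  refine ⟨1, ?_⟩
  filter_upwards [eventually_ge_atTop 1] with τ hτ
  let J := Finset.Icc ⌈-(τ * max 0 (-Real.cos θ))⌉ ⌊τ * max 0 (Real.cos θ)⌋
  refine ⟨J.card, (le_card_Icc_ceil_floor _ _).trans' ?_,
    le_separatedNumber_of_supportedOn hm hε J fun x y hx hy hxy => funext fun i => ?_⟩
  · rw [coneGrowth, hθ]
    norm_num
    linarith
  by_cases hi : i ∈ J
  · obtain ⟨hi₁, hi₂⟩ := mem_Icc_ceil_floor.1 hi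
    exact hxy i 0 (by simpa using mem_window_zero_of_sin_eq_zero hθ hw hτ hi₁ hi₂)
  · rw [hx i hi, hy i hi]

lemma le_separatedNumber_of_torsion {m r : ℕ} (hm : 1 < m) (a : Nbhd r → ZMod m) {q : ZMod m}
    (hq : IsNilpotent q) {ε : ℝ} (hε : ε ≤ 1) {W : Set (ℝ × ℝ)} (J : Finset ℤ)
    (h : ∀ z : Config m, q • z = 0 → (∀ i ∉ J, z i = 0) →
      (∀ (n : ℤ) (t : ℕ), ((n : ℝ), (t : ℝ)) ∈ W → (linearAutomaton a ^ t) z n = 0) → z = 0) :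
    (m ^ J.card : ℕ) ≤ separatedNumber (cellularAutomaton (linearRule a)) ε W := by
  refine le_separatedNumber_of_supportedOn hm hε J fun x y hx hy hxy => sub_eq_zero.1 ?_
  simp only [iterate_cellularAutomaton_linearRule] at hxy
  let invisible : Set (Config m) := {z | (∀ i ∉ J, z i = 0) ∧
    ∀ (n : ℤ) (t : ℕ), ((n : ℝ), (t : ℝ)) ∈ W → (linearAutomaton a ^ t) z n = 0}
  refine eq_zero_of_isNilpotent hq (s := invisible) (fun z hz => ⟨fun i hi => ?_, fun n t hW => ?_⟩)
    (fun z hz hqz => h z hqz hz.1 hz.2) ⟨fun i hi => ?_, fun n t hW => ?_⟩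
  · rw [Pi.smul_apply, hz.1 i hi, smul_zero]
  · rw [map_smul, Pi.smul_apply, hz.2 n t hW, smul_zero]
  · rw [Pi.sub_apply, hx i hi, hy i hi, sub_zero]
  · rw [map_sub, Pi.sub_apply, hxy n t hW, sub_self]

variable {p k r : ℕ} {a : Nbhd r → ZMod (p ^ k)} {L R : ℤ} {ε θ : ℝ}

lemma growsAtLeast_of_sin_pos (hp : p.Prime) (hk : 1 ≤ k) (hL : IsLeast (unitSupport a) L)
    (hR : IsGreatest (unitSupport a) R) (hε : ε ≤ 1) (hθ : 0 < Real.sin θ) {w : ℕ}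
    (hw : 2 * (|Real.cot θ| + |(L : ℝ)| + |(R : ℝ)|) < w) :
    GrowsAtLeast (p ^ k)
      (fun τ => separatedNumber (cellularAutomaton (linearRule a)) ε (window w τ θ))
      (coneGrowth L R θ) := by
  set α := max 0 (-(Real.cot θ + L))
  set β := max 0 (Real.cot θ + R)
  have hαβ : 0 ≤ β + α := add_nonneg (le_max_left _ _) (le_max_left _ _)
  refine ⟨β + α + 1, ?_⟩
  filter_upwards [eventually_ge_atTop (1 / Real.sin θ)] with τ hτ
  rw [div_le_iff₀ hθ] at hτ
  obtain ⟨s, hs⟩ := Nat.exists_eq_add_of_le' ((Nat.one_le_floor_iff _).2 hτ)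
  have hs_le : (s + 1 : ℝ) ≤ τ * Real.sin θ := by
    exact_mod_cast hs ▸ Nat.floor_le (zero_le_one.trans hτ)
  have hs_gt : τ * Real.sin θ < s + 1 + 1 := by
    exact_mod_cast hs ▸ Nat.lt_floor_add_one (τ * Real.sin θ)
  let J := Finset.Icc ⌈-((s + 1) * α)⌉ ⌊(s + 1) * β⌋
  refine ⟨J.card, (le_card_Icc_ceil_floor _ _).trans' ?_,
    le_separatedNumber_of_torsion (Nat.one_lt_pow (by lia) hp.one_lt) a
      ⟨k, natCast_prime_pow_eq_zero p k⟩ hε J fun z hz hsupp hinvisible =>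
        eq_zero_of_strip hp hL hR hw hz (τ := s) (fun i hi => ?_) fun t ht n hn => ?_⟩
  · rw [coneGrowth_eq_sin_mul _ _ hθ]
    nlinarith
  · exact mem_Icc_ceil_floor.1 (not_imp_comm.1 (hsupp i) hi)
  · refine hinvisible n (t + 1) ((mem_window_iff_of_sin_pos hθ).2 ?_)
    have ht' : (t : ℝ) ≤ s := by exact_mod_cast ht
    push_cast
    exact ⟨hn, by positivity, by linarith⟩

lemma growsAtMost_separatedNumber (hp : p.Prime) (hk : 1 ≤ k) (hL : IsLeast (unitSupport a) L)
    (hR : IsGreatest (unitSupport a) R) (hε : 0 < ε) (w : ℕ) :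
    GrowsAtMost (p ^ k)
      (fun τ => separatedNumber (cellularAutomaton (linearRule a)) ε (window w τ θ))
      (coneGrowth L R θ) := by
  have hm : 1 < p ^ k := Nat.one_lt_pow (by lia) hp.one_lt
  have : NeZero (p ^ k) := ⟨by lia⟩
  obtain ⟨K, hK⟩ := exists_configDist_lt hm hε
  have hneighborhood := hasNeighborhood_linearAutomaton_pow (natCast_prime_pow_eq_zero p k)
    (abs_le_of_mem_unitSupport hL.1) (abs_le_of_mem_unitSupport hR.1)
    fun j hj => dvd_of_not_isUnit hp (not_isUnit_of_notMem_Icc hL.2 hR.2 hj)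
  set α := max 0 (-(Real.cos θ + L * Real.sin θ))
  set β := max 0 (Real.cos θ + R * Real.sin θ)
  have hα₀ : 0 ≤ α := le_max_left _ _
  have hβ₀ : 0 ≤ β := le_max_left _ _
  let D : ℝ := w + K + 2 * r * k
  have hD : 0 ≤ D := by positivity
  refine ⟨2 * D + 1, ?_⟩
  filter_upwards [eventually_ge_atTop 0] with τ hτ
  let J := Finset.Icc ⌈-(D + τ * α)⌉ ⌊D + τ * β⌋
  refine ⟨J.card, (card_Icc_ceil_floor_le (by nlinarith)).trans (by rw [coneGrowth]; linarith),
    separatedNumber_le_of_agreeOn J fun x y hxy n t hW => hK _ _ fun i hi => ?_⟩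
  rw [shiftAction, shiftAction, iterate_cellularAutomaton_linearRule]
  refine (hneighborhood t).apply_eq fun l hl => hxy l (mem_Icc_ceil_floor.2 ?_)
  obtain ⟨hiK, hiK'⟩ : -(K : ℝ) ≤ i ∧ (i : ℝ) ≤ K := by constructor <;> norm_cast <;> lia
  have hl₁ : (i : ℝ) + n + (L * t - 2 * r * k) ≤ l := by exact_mod_cast hl.1
  have hl₂ : (l : ℝ) ≤ i + n + (R * t + 2 * r * k) := by exact_mod_cast hl.2
  have hleft := neg_le_add_mul_of_mem_window hW L
  have hright := add_mul_le_of_mem_window hW R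
  constructor <;> linarith

lemma hasDirectionalEntropy_coneGrowth (hp : p.Prime) (hk : 1 ≤ k) (hL : IsLeast (unitSupport a) L)
    (hR : IsGreatest (unitSupport a) R) (hθ : θ ∈ Set.Icc 0 Real.pi) :
    HasDirectionalEntropy (cellularAutomaton (linearRule a)) θ
      (k * coneGrowth L R θ * Real.log p) := by
  have hm : 1 < p ^ k := Nat.one_lt_pow (by lia) hp.one_lt
  rw [mul_comm (k : ℝ), mul_assoc, ← Real.log_pow, ← Nat.cast_pow]
  refine hasDirectionalEntropy_of_growth (zero_lt_one.trans hm) ?_ ?_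
  · filter_upwards [Ioc_mem_nhdsGT one_pos] with ε hε
    rcases (Real.sin_nonneg_of_mem_Icc hθ).eq_or_lt' with hsin | hsin
    · filter_upwards [eventually_gt_atTop 1] with w hw
      exact growsAtLeast_of_sin_eq_zero hm _ L R hε.2 hsin hw
    · filter_upwards [tendsto_natCast_atTop_atTop.eventually_gt_atTop
        (2 * (|Real.cot θ| + |(L : ℝ)| + |(R : ℝ)|))] with w hw
      exact growsAtLeast_of_sin_pos hp hk hL hR hε.2 hsin hw
  · filter_upwards [self_mem_nhdsWithin] with ε hε
    exact .of_forall (growsAtMost_separatedNumber hp hk hL hR hε)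

end Entropy

theorem mainTheorem2_general {p k r : ℕ} (hp : p.Prime) (hk : 1 ≤ k) (a : Nbhd r → ZMod (p ^ k))
    {L R : ℤ} (hL : IsLeast (unitSupport a) L) (hR : IsGreatest (unitSupport a) R) :
    (∀ θ ∈ Set.Icc 0 (arccot (-(L : ℝ))),
      HasDirectionalEntropy (cellularAutomaton (linearRule a)) θ
        (k * |Real.cos θ + R * Real.sin θ| * Real.log p)) ∧
    (∀ θ ∈ Set.Icc (arccot (-(L : ℝ))) (arccot (-(R : ℝ))),
      HasDirectionalEntropy (cellularAutomaton (linearRule a)) θ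
        (k * |((R : ℝ) - L) * Real.sin θ| * Real.log p)) ∧
    (∀ θ ∈ Set.Icc (arccot (-(R : ℝ))) Real.pi,
      HasDirectionalEntropy (cellularAutomaton (linearRule a)) θ
        (k * |Real.cos θ + L * Real.sin θ| * Real.log p)) := by
  have hLR : (L : ℝ) ≤ R := by exact_mod_cast hR.2 hL.1
  obtain ⟨hL₀, hLπ⟩ := arccot_mem_Ioo (-(L : ℝ))
  obtain ⟨hR₀, hRπ⟩ := arccot_mem_Ioo (-(R : ℝ))
  refine ⟨fun θ hθ => ?_, fun θ hθ => ?_, fun θ hθ => ?_⟩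
  · rw [← coneGrowth_of_le_arccot hLR hθ]
    exact hasDirectionalEntropy_coneGrowth hp hk hL hR ⟨hθ.1, hθ.2.trans hLπ.le⟩
  · rw [← coneGrowth_of_mem_Icc_arccot hLR hθ]
    exact hasDirectionalEntropy_coneGrowth hp hk hL hR ⟨hL₀.le.trans hθ.1, hθ.2.trans hRπ.le⟩
  · rw [← coneGrowth_of_arccot_le hLR hθ]
    exact hasDirectionalEntropy_coneGrowth hp hk hL hR ⟨hR₀.le.trans hθ.1, hθ.2⟩

theorem mainTheorem2 (p k r : ℕ) (hp : p.Prime) (hk : 1 ≤ k)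
    (a : Nbhd r → ZMod (p ^ k))
    (hleft : ∃ i : Nbhd r, (i : ℤ) < 0 ∧ IsPermutativeIn (linearRule a) i)
    (hright : ∃ j : Nbhd r, 0 < (j : ℤ) ∧ IsPermutativeIn (linearRule a) j)
    (L R : ℤ) (hL : IsLeast (unitPositions p a) L) (hR : IsGreatest (unitPositions p a) R) :
    (∀ θ ∈ Set.Icc 0 (arccot (-(L : ℝ))),
      HasDirectionalEntropy (cellularAutomaton (linearRule a)) θ
        (k * |Real.cos θ + R * Real.sin θ| * Real.log p)) ∧
    (∀ θ ∈ Set.Icc (arccot (-(L : ℝ))) (arccot (-(R : ℝ))),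
      HasDirectionalEntropy (cellularAutomaton (linearRule a)) θ
        (k * |((R : ℝ) - L) * Real.sin θ| * Real.log p)) ∧
    (∀ θ ∈ Set.Icc (arccot (-(R : ℝ))) Real.pi,
      HasDirectionalEntropy (cellularAutomaton (linearRule a)) θ
        (k * |Real.cos θ + L * Real.sin θ| * Real.log p)) := by
  rw [unitPositions_eq_insert hp hk] at hL hR
  obtain ⟨i, hi, hperm_i⟩ := hleft
  obtain ⟨j, hj, hperm_j⟩ := hright
  have hi_mem : (i : ℤ) ∈ unitSupport a :=
    Set.mem_image_of_mem _ (isUnit_of_isPermutativeIn hperm_i)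
  have hj_mem : (j : ℤ) ∈ unitSupport a :=
    Set.mem_image_of_mem _ (isUnit_of_isPermutativeIn hperm_j)
  exact mainTheorem2_general hp hk a (isLeast_of_isLeast_insert hL hi_mem hi)
    (isLeast_of_isLeast_insert (α := ℤᵒᵈ) hR hj_mem hj)
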